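/- Let $n, k, r$ be integers with $n \ge 1$, $0 \le k \le n$ and $r \ge 1$. For $0 \le d \le n$ put $e_d(\mathbf{x}_n^r) := \sum_{1 \le j_1 < \cdots < j_d \le n} x_{j_1}^r \cdots x_{j_d}^r \in \mathbb{C}[x_1,\dots,x_n]$, and let $$S_{n,k} := \mathbb{C}[x_1,\dots,x_n]/J_{n,k}, \qquad J_{n,k} := \langle x_1^{kr}, \dots, x_n^{kr},\ e_n(\mathbf{x}_n^r), e_{n-1}(\mathbf{x}_n^r), \dots, e_{n-k+1}(\mathbf{x}_n^r) \rangle .$$ Let $G_n$ be the set of $r$-colored permutations $g = \pi_1^{c_1} \cdots \pi_n^{c_n}$, where $\pi_1 \cdots \pi_n$ is a permutation of $\{1,\dots,n\}$ and $c_1,\dots,c_n \in \{0,1,\dots,r-1\}$. Order colored letters by $a^c < b^d$ if and only if $c > d$, or $c = d$ and $a < b$. Let $\mathrm{Des}(g) := \{1 \le i \le n-1 : \pi_i^{c_i} > \pi_{i+1}^{c_{i+1}}\}$, $\mathrm{des}(g) := |\mathrm{Des}(g)|$, $d_i(g) := |\{j \in \mathrm{Des}(g) : j \ge i\}|$, and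 let $$b_g := \prod_{i=1}^n x_{\pi_i}^{r d_i(g) + c_i}$$ be the Bango–Biagioli descent monomial of $g$. Let $\mathcal{D}_{n,k}$ be the set of all monomials of the form $$b_g \cdot x_{\pi_1}^{r i_1} \cdots x_{\pi_{n-k}}^{r i_{n-k}},$$ where $g = \pi_1^{c_1}\cdots\pi_n^{c_n} \in G_n$ satisfies $\mathrm{des}(g) < k$ and the integers $i_1, \dots, i_{n-k}$ satisfy $k - \mathrm{des}(g) > i_1 \ge \cdots \ge i_{n-k} \ge 0$. **Theorem.** The set $\mathcal{D}_{n,k}$ of $(n,k)$-descent monomials descends to a basis of the complex vector space $S_{n,k}$; that is, the residue classes modulo $J_{n,k}$ of the elements of $\mathcal{D}_{n,k}$ are pairwise distinct and form a $\mathbb{C}$-basis of $S_{n,k}$. -/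

import Mathlib

open MvPolynomial

namespace DescentBasis

/-- The `d`-th elementary symmetric polynomial in the variable powers,
`e_d(x_1^r, …, x_n^r) ∈ ℂ[x_1, …, x_n]`. -/
noncomputable def esymmPow (n r d : ℕ) : MvPolynomial (Fin n) ℂ :=
  ∑ t ∈ Finset.powersetCard d Finset.univ, ∏ i ∈ t, X i ^ r

/-- The ideal `J_{n,k} = ⟨x_1^{kr}, …, x_n^{kr}, e_n(x^r), e_{n-1}(x^r), …, e_{n-k+1}(x^r)⟩`
(for `k ≤ n`). -/
noncomputable def idealJ (n k r : ℕ) : Ideal (MvPolynomial (Fin n) ℂ) :=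
  Ideal.span
    ({p | ∃ i : Fin n, p = X i ^ (k * r)} ∪
      {p | ∃ d : ℕ, n - k + 1 ≤ d ∧ d ≤ n ∧ p = esymmPow n r d})

/-- The quotient ring `S_{n,k} = ℂ[x_1, …, x_n] / J_{n,k}`. -/
abbrev QuotS (n k r : ℕ) : Type :=
  MvPolynomial (Fin n) ℂ ⧸ idealJ n k r

/-- An `r`-colored permutation `g = π_1^{c_1} … π_n^{c_n}`, that is, an element of `G_n`:
a permutation `π` together with a color `c_i ∈ {0, …, r-1}` for each position `i`.
Positions and letters are `0, …, n-1` here. -/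
structure ColoredPerm (n r : ℕ) where
  perm : Equiv.Perm (Fin n)
  color : Fin n → Fin r

/-- The order `<` on colored letters `a^c`, in which colors weigh more than letter values and
higher colors are smaller: `a^c < b^d` iff `c > d`, or `c = d` and `a < b`. -/
def LetterLT {n r : ℕ} (x y : Fin n × Fin r) : Prop :=
  y.2 < x.2 ∨ (x.2 = y.2 ∧ x.1 < y.1)

instance {n r : ℕ} (x y : Fin n × Fin r) : Decidable (LetterLT x y) :=
  inferInstanceAs (Decidable (y.2 < x.2 ∨ (x.2 = y.2 ∧ x.1 < y.1)))

namespace ColoredPerm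

variable {n r : ℕ}

/-- The colored letter `π_i^{c_i}` in position `i`. -/
def letter (g : ColoredPerm n r) (i : Fin n) : Fin n × Fin r :=
  (g.perm i, g.color i)

/-- The descent set: the positions `i`, other than the last one, with
`π_i^{c_i} > π_{i+1}^{c_{i+1}}`. -/
def Des (g : ColoredPerm n r) : Finset (Fin n) :=
  Finset.univ.filter fun i =>
    ∃ h : i.val + 1 < n, LetterLT (g.letter ⟨i.val + 1, h⟩) (g.letter i)

/-- The number of descents. -/
def des (g : ColoredPerm n r) : ℕ := g.Des.card

/-- `d_i(g)`, the number of descents `j` of `g` with `j ≥ i`. -/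
def dseq (g : ColoredPerm n r) (i : Fin n) : ℕ :=
  (g.Des.filter fun j => i ≤ j).card

/-- The descent monomial `b_g = ∏_i x_{π_i}^{r d_i(g) + c_i}`. -/
noncomputable def descentMonomial (g : ColoredPerm n r) : MvPolynomial (Fin n) ℂ :=
  ∏ i : Fin n, X (g.perm i) ^ (r * g.dseq i + (g.color i).val)

end ColoredPerm

/-- The set `D_{n,k}` of `(n,k)`-descent monomials (for `k ≤ n`): all
`b_g · x_{π_1}^{r i_1} ⋯ x_{π_{n-k}}^{r i_{n-k}}` with `des(g) < k` and
`k - des(g) > i_1 ≥ ⋯ ≥ i_{n-k} ≥ 0`. -/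
def descentMonomials (n k r : ℕ) : Set (MvPolynomial (Fin n) ℂ) :=
  {m | ∃ (g : ColoredPerm n r) (e : Fin (n - k) → ℕ),
    g.des < k ∧ Antitone e ∧ (∀ j, e j < k - g.des) ∧
    m = g.descentMonomial *
      ∏ j : Fin (n - k), X (g.perm (Fin.castLE (Nat.sub_le n k) j)) ^ (r * e j)}

end DescentBasis

/-!
Let `ω` be a primitive `r`-th root of unity. The points with coordinates `(f j + 1) ω ^ c j`, for
`c` a coloring of the `n` letters and `f` a surjection of the letters onto `k` blocks, form a
finite set `V`. Each generator of `J_{n,k}` is the leading form of a polynomial vanishing on `V`: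
for `x_i^{kr}` this is `∏_b (x_i^r - (b + 1)^r)`, and for `e_d(x^r)` with `d > n - k` one uses
that `∏_i (1 + x_i^r t) / ∏_b (1 + (b + 1)^r t)` is a polynomial in `t` of degree at most `n - k`
on `V`. Hence `dim S_{n,k} ≥ |V|`.

The set `D_{n,k}` has at most `|V|` elements: the data `(g, e)` amount to `g` and `n - k` of its
ascents, and joining the word of `g` at these ascents gives an ordered partition of the colored
letters into `k` blocks, from which `g` is recovered by sorting.

So it suffices that `D_{n,k}` spans. Sorting the exponents of a monomial writes it as
`∏_i x_{π_i}^{r (d_i(g) + u_i) + c_i}` with `u` weakly decreasing. If all exponents are below `kr`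
and the monomial is not in `D_{n,k}`, then the set `T` of letters `π_i` with `u_i > 0` has more
than `n - k` elements, and `x^a` is the term indexed by `T` of `x^b e_{|T|}(x^r)`, where
`a = b + r 1_T`. The letters in `T` have larger weights `n b_j + n - j` than the others, so the sum
of squared weights is largest at the term `x^a` of this product, and modulo `J_{n,k}` one can
replace `x^a` by terms for which it is smaller.
-/

namespace DescentBasis

section RestrictSupport

variable {σ K : Type*} [CommSemiring K]

lemma mem_restrictSupport_degree_lt_of_isHomogeneous {d e : ℕ} {p : MvPolynomial σ K}
    (hp : p.IsHomogeneous d) (h : d < e) : p ∈ restrictSupport K {a | a.degree < e} := by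
  rw [mem_restrictSupport_iff]
  intro a ha
  exact (Finsupp.degree_eq_weight_one (R := ℕ) ▸ hp (mem_support_iff.1 ha)).trans_lt h

lemma monomial_mul_mem_restrictSupport_degree_lt {d : ℕ} {p : MvPolynomial σ K}
    (hp : p ∈ restrictSupport K {a | a.degree < d}) (b : σ →₀ ℕ) (c : K) :
    monomial b c * p ∈ restrictSupport K {a | a.degree < b.degree + d} := by
  have hb : monomial b c ∈ restrictSupport K {b} :=
    (monomial_mem_restrictSupport K).2 (Or.inl rfl)
  have hbp := Submodule.mul_mem_mul hb hp
  rw [← restrictSupport_add] at hbp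
  refine restrictSupport_mono K ?_ hbp
  rintro _ ⟨_, rfl, a, ha, rfl⟩
  simpa using ha

lemma homogeneousComponent_mem_restrictSupport {B : Set (σ →₀ ℕ)} {p : MvPolynomial σ K}
    (hp : p ∈ restrictSupport K B) (e : ℕ) :
    homogeneousComponent e p ∈ restrictSupport K B := by
  rw [mem_restrictSupport_iff, support_homogeneousComponent] at *
  exact (Finset.coe_subset.2 (Finset.filter_subset _ _)).trans hp

end RestrictSupport

section LeadingForms

variable {σ K : Type*} [CommRing K]

/-- The degree-`d` leading forms of an ideal `I`: the homogeneous polynomials of degree `d` that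
agree modulo `I` with a polynomial of smaller degree. For `I` the vanishing ideal of a finite set
of points, this is the degree-`d` part of the ideal whose quotient is the associated graded ring
of the coordinate ring. -/
noncomputable def leadingForms (I : Ideal (MvPolynomial σ K)) (d : ℕ) :
    Submodule K (MvPolynomial σ K) :=
  homogeneousSubmodule σ K d ⊓
    (restrictSupport K {a | a.degree < d} ⊔ I.restrictScalars K)

lemma mem_leadingForms_of_add_mem {I : Ideal (MvPolynomial σ K)} {d : ℕ}
    {p q : MvPolynomial σ K} (hp : p.IsHomogeneous d)
    (hq : q ∈ restrictSupport K {a | a.degree < d}) (h : p + q ∈ I) : p ∈ leadingForms I d := by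
  refine ⟨hp, ?_⟩
  rw [← neg_add_cancel_comm_assoc q p]
  exact add_mem (Submodule.mem_sup_left (neg_mem hq)) (Submodule.mem_sup_right h)

lemma X_pow_natDegree_mem_leadingForms {I : Ideal (MvPolynomial σ K)}
    {p : Polynomial K} (hp : p.Monic) {i : σ}
    (h : Polynomial.aeval (X i) p ∈ I) : X i ^ p.natDegree ∈ leadingForms I p.natDegree := by
  rw [hp.as_sum] at h
  simp only [map_add, map_sum, map_pow, map_mul, Polynomial.aeval_X, Polynomial.aeval_C] at h
  refine mem_leadingForms_of_add_mem (isHomogeneous_X_pow i _) (sum_mem fun m hm ↦ ?_) h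
  exact mem_restrictSupport_degree_lt_of_isHomogeneous
    ((isHomogeneous_X_pow i m).C_mul _) (Finset.mem_range.1 hm)

lemma monomial_mul_mem_leadingForms {I : Ideal (MvPolynomial σ K)} {d : ℕ}
    {f : MvPolynomial σ K} (hf : f ∈ leadingForms I d) (b : σ →₀ ℕ) (c : K) :
    monomial b c * f ∈ leadingForms I (b.degree + d) := by
  refine ⟨(isHomogeneous_monomial c rfl).mul hf.1, ?_⟩
  obtain ⟨q, hq, s, hs, rfl⟩ := Submodule.mem_sup.1 hf.2
  rw [mul_add]
  exact add_mem (Submodule.mem_sup_left (monomial_mul_mem_restrictSupport_degree_lt hq b c))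
    (Submodule.mem_sup_right (I.mul_mem_left _ hs))

lemma homogeneousComponent_mul_mem_leadingForms {I : Ideal (MvPolynomial σ K)} {d : ℕ}
    {f : MvPolynomial σ K} (hf : f ∈ leadingForms I d) (q : MvPolynomial σ K) (e : ℕ) :
    homogeneousComponent e (q * f) ∈ leadingForms I e := by
  induction q using MvPolynomial.induction_on' with
  | monomial b c =>
    have hbf := monomial_mul_mem_leadingForms hf b c
    rw [homogeneousComponent_of_mem hbf.1]
    split_ifs with h
    · exact h ▸ hbf
    · exact zero_mem _
  | add q₁ q₂ h₁ h₂ => simpa only [add_mul, map_add] using add_mem h₁ h₂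

lemma homogeneousComponent_mem_leadingForms {I : Ideal (MvPolynomial σ K)}
    {S : Set (MvPolynomial σ K)} (hS : ∀ f ∈ S, ∃ d, f ∈ leadingForms I d)
    {p : MvPolynomial σ K} (hp : p ∈ Ideal.span S) (e : ℕ) :
    homogeneousComponent e p ∈ leadingForms I e := by
  suffices h : ∀ q, homogeneousComponent e (q * p) ∈ leadingForms I e by simpa using h 1
  induction hp using Submodule.span_induction with
  | mem f hf => exact fun q ↦ homogeneousComponent_mul_mem_leadingForms (hS f hf).choose_spec q e
  | zero => simp
  | add p₁ p₂ _ _ h₁ h₂ =>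
    exact fun q ↦ by simpa only [mul_add, map_add] using add_mem (h₁ q) (h₂ q)
  | smul c p _ h => exact fun q ↦ by simpa only [smul_eq_mul, mul_assoc] using h (q * c)

lemma restrictSupport_sup_eq_top {I J : Ideal (MvPolynomial σ K)} {B : Set (σ →₀ ℕ)}
    (hJ : ∀ p ∈ J, ∀ e, homogeneousComponent e p ∈ leadingForms I e)
    (hB : restrictSupport K B ⊔ J.restrictScalars K = ⊤) :
    restrictSupport K B ⊔ I.restrictScalars K = ⊤ := by
  have monomial_mem (e : ℕ) : ∀ a : σ →₀ ℕ, a.degree = e →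
      monomial a (1 : K) ∈ restrictSupport K B ⊔ I.restrictScalars K := by
    induction e using Nat.strong_induction_on with | _ e ih =>
    intro a ha
    obtain ⟨b, hb, j, hj, hbj⟩ :=
      Submodule.mem_sup.1 (hB ▸ Submodule.mem_top : monomial a (1 : K) ∈ _)
    have hlow : restrictSupport K {a : σ →₀ ℕ | a.degree < e} ≤
        restrictSupport K B ⊔ I.restrictScalars K := by
      rw [restrictSupport_eq_span, Submodule.span_le]
      rintro _ ⟨a, ha, rfl⟩
      exact ih _ ha a rfl
    have hcomp : monomial a (1 : K) = homogeneousComponent e b + homogeneousComponent e j := by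
      rw [← map_add, hbj, homogeneousComponent_of_mem (isHomogeneous_monomial 1 ha), if_pos rfl]
    rw [hcomp]
    exact add_mem (Submodule.mem_sup_left (homogeneousComponent_mem_restrictSupport hb e))
      (sup_le hlow le_sup_right (hJ j hj e).2)
  rw [eq_top_iff, ← restrictSupport_univ, restrictSupport_eq_span, Submodule.span_le]
  rintro _ ⟨a, -, rfl⟩
  exact monomial_mem _ a rfl

end LeadingForms

lemma span_mk_monomial_eq_top_iff {σ K : Type*} [CommRing K] {I : Ideal (MvPolynomial σ K)}
    {B : Set (σ →₀ ℕ)} :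
    Submodule.span K (Ideal.Quotient.mk I '' ((monomial · 1) '' B)) = ⊤ ↔
      restrictSupport K B ⊔ I.restrictScalars K = ⊤ := by
  have hker : I.restrictScalars K = (Ideal.Quotient.mkₐ K I).toLinearMap.ker := by
    ext x
    simp [Ideal.Quotient.eq_zero_iff_mem]
  rw [hker, ← LinearMap.map_eq_top_iff
    (LinearMap.range_eq_top.2 (Ideal.Quotient.mkₐ_surjective K I)), restrictSupport_eq_span,
    Submodule.map_span]
  rfl

lemma rank_quotient_le_of_homogeneousComponent_mem_leadingForms {σ K : Type*} [Field K]
    {I J : Ideal (MvPolynomial σ K)}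
    (hJ : ∀ p ∈ J, ∀ e, homogeneousComponent e p ∈ leadingForms I e) :
    Module.rank K (MvPolynomial σ K ⧸ I) ≤ Module.rank K (MvPolynomial σ K ⧸ J) := by
  obtain ⟨S, hS, -, hspan, hli⟩ := exists_linearIndepOn_extension (K := K)
    (v := Ideal.Quotient.mk J) (linearIndepOn_empty K _)
    (Set.empty_subset (Set.range fun a : σ →₀ ℕ ↦ monomial a (1 : K)))
  obtain ⟨B, rfl⟩ := Set.subset_range_iff_exists_image_eq.1 hS
  have hB : restrictSupport K B ⊔ J.restrictScalars K = ⊤ := by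
    rw [← span_mk_monomial_eq_top_iff, eq_top_iff, ← span_mk_monomial_eq_top_iff.2
      (show restrictSupport K Set.univ ⊔ J.restrictScalars K = ⊤ by simp), Submodule.span_le]
    simpa using hspan
  calc Module.rank K (MvPolynomial σ K ⧸ I)
      ≤ Cardinal.mk (Ideal.Quotient.mk I '' ((monomial · 1) '' B)) := by
        rw [← rank_top, ← span_mk_monomial_eq_top_iff.2 (restrictSupport_sup_eq_top hJ hB)]
        exact rank_span_le _
    _ ≤ Cardinal.mk ((monomial · (1 : K)) '' B) := Cardinal.mk_image_le
    _ ≤ Module.rank K (MvPolynomial σ K ⧸ J) := hli.linearIndependent.cardinal_le_rank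

section Interpolation

variable {σ ι K : Type*} [Field K] [Finite ι]

lemma surjective_aeval_of_injective {x : ι → σ → K} (hx : Function.Injective x) :
    Function.Surjective (AlgHom.pi fun p ↦ aeval (R := K) (x p)) := by
  have hcoprime : Pairwise fun p q ↦ IsCoprime (RingHom.ker (aeval (R := K) (x p)))
      (RingHom.ker (aeval (R := K) (x q))) := by
    intro p q hpq
    obtain ⟨s, hs⟩ := Function.ne_iff.1 (hx.ne hpq)
    have hs' : x q s - x p s ≠ 0 := sub_ne_zero.2 hs.symm
    refine Ideal.isCoprime_iff_exists.2 ⟨C (x q s - x p s)⁻¹ * (X s - C (x p s)), ?_,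
      C (x q s - x p s)⁻¹ * (C (x q s) - X s), ?_, ?_⟩
    · simp
    · simp
    · rw [← mul_add, sub_add_sub_cancel', ← C_sub, ← C_mul, inv_mul_cancel₀ hs', C_1]
  intro v
  obtain ⟨q, hq⟩ := Ideal.exists_forall_sub_mem_ideal hcoprime fun p ↦ C (v p)
  refine ⟨q, funext fun p ↦ ?_⟩
  simpa [sub_eq_zero] using hq p

lemma finrank_quotient_vanishingIdeal_range {x : ι → σ → K} (hx : Function.Injective x) :
    Module.finrank K (MvPolynomial σ K ⧸ vanishingIdeal K (Set.range x)) = Nat.card ι := by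
  have hker : vanishingIdeal K (Set.range x) =
      RingHom.ker (AlgHom.pi fun p ↦ aeval (R := K) (x p)) := by
    ext q
    rw [mem_vanishingIdeal_iff, Set.forall_mem_range]
    simp [RingHom.mem_ker, funext_iff]
  have := Fintype.ofFinite ι
  rw [hker, (Ideal.quotientKerAlgEquivOfSurjective
    (surjective_aeval_of_injective hx)).toLinearEquiv.finrank_eq,
    Module.finrank_fintype_fun_eq_card, Nat.card_eq_fintype_card]

end Interpolation

section Generators

lemma coeff_prod_one_add_C_mul_X {ι R : Type*} [Fintype ι] [CommSemiring R] (y : ι → R) (d : ℕ) :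
    PowerSeries.coeff d (∏ i, (1 + PowerSeries.C (y i) * PowerSeries.X)) =
      ∑ t ∈ Finset.powersetCard d Finset.univ, ∏ i ∈ t, y i := by
  classical
  rw [Finset.prod_one_add, map_sum, Finset.powersetCard_eq_filter, Finset.sum_filter]
  refine Finset.sum_congr rfl fun t _ ↦ ?_
  rw [Finset.prod_mul_distrib, Finset.prod_const, ← map_prod, PowerSeries.coeff_C_mul_X_pow]
  simp only [eq_comm]

lemma coeff_prod_one_add_C_mul_X_eq_zero {ι R : Type*} [CommSemiring R] (s : Finset ι) (y : ι → R)
    {d : ℕ} (hd : s.card < d) :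
    PowerSeries.coeff d (∏ i ∈ s, (1 + PowerSeries.C (y i) * PowerSeries.X)) = 0 := by
  rw [← Finset.prod_coe_sort, coeff_prod_one_add_C_mul_X, Finset.powersetCard_eq_empty.2
    (by simpa using hd), Finset.sum_empty]

lemma coeff_prod_one_add_mul_inv_eq_zero {ι κ K : Type*} [Fintype ι] [Fintype κ] [Field K]
    (α : κ → K) {f : ι → κ} (hf : Function.Surjective f) {d : ℕ}
    (hd : Fintype.card ι < d + Fintype.card κ) :
    PowerSeries.coeff d ((∏ i, (1 + PowerSeries.C (α (f i)) * PowerSeries.X)) *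
      (∏ b, (1 + PowerSeries.C (α b) * PowerSeries.X))⁻¹) = 0 := by
  classical
  obtain ⟨s, hs⟩ := hf.hasRightInverse
  let T := Finset.univ.map ⟨s, hs.injective⟩
  have hT : ∏ b, (1 + PowerSeries.C (α b) * PowerSeries.X) =
      ∏ i ∈ T, (1 + PowerSeries.C (α (f i)) * PowerSeries.X) := by
    simp [T, Finset.prod_map, hs _]
  rw [← Finset.prod_compl_mul_prod T, hT, mul_assoc, PowerSeries.mul_inv_cancel _ (by simp),
    mul_one]
  refine coeff_prod_one_add_C_mul_X_eq_zero _ _ ?_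
  have hcard := Fintype.card_le_of_surjective f hf
  simp only [T, Finset.card_compl, Finset.card_map, Finset.card_univ]
  omega

/-- The exponent of the monomial `∏ i ∈ t, X i ^ r`. -/
noncomputable def setExp {σ : Type*} (r : ℕ) (t : Finset σ) : σ →₀ ℕ :=
  ∑ i ∈ t, Finsupp.single i r

lemma degree_setExp {σ : Type*} (r : ℕ) (t : Finset σ) : (setExp r t).degree = t.card * r := by
  simp [setExp]

lemma setExp_apply {σ : Type*} [DecidableEq σ] (r : ℕ) (t : Finset σ) (j : σ) :
    setExp r t j = if j ∈ t then r else 0 := by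
  simp [setExp, Finsupp.finsetSum_apply, Finsupp.single_apply]

variable {n k r : ℕ}

lemma esymmPow_eq_sum_monomial (n r d : ℕ) :
    esymmPow n r d = ∑ t ∈ Finset.powersetCard d Finset.univ, monomial (setExp r t) 1 := by
  simp [esymmPow, setExp, monomial_sum_one, X_pow_eq_monomial]

lemma isHomogeneous_esymmPow (n r d : ℕ) : (esymmPow n r d).IsHomogeneous (d * r) := by
  rw [esymmPow_eq_sum_monomial]
  refine IsHomogeneous.sum _ _ _ fun t ht ↦ isHomogeneous_monomial 1 ?_
  rw [degree_setExp, (Finset.mem_powersetCard.1 ht).2]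

lemma aeval_esymmPow (x : Fin n → ℂ) (r d : ℕ) :
    aeval x (esymmPow n r d) =
      PowerSeries.coeff d (∏ i, (1 + PowerSeries.C (x i ^ r) * PowerSeries.X)) := by
  rw [coeff_prod_one_add_C_mul_X, esymmPow]
  simp

variable {V : Set (Fin n → ℂ)} {α : Fin k → ℂ}

lemma X_pow_mem_leadingForms [NeZero r] (hV : ∀ x ∈ V, ∀ i, ∃ b, x i ^ r = α b) (i : Fin n) :
    X i ^ (k * r) ∈ leadingForms (vanishingIdeal ℂ V) (k * r) := by
  have hmonic (b : Fin k) : (Polynomial.X ^ r - Polynomial.C (α b)).Monic :=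
    Polynomial.monic_X_pow_sub_C _ (NeZero.ne r)
  have hdeg : (∏ b, (Polynomial.X ^ r - Polynomial.C (α b))).natDegree = k * r := by
    simp [Polynomial.natDegree_prod_of_monic _ _ fun b _ ↦ hmonic b]
  rw [← hdeg]
  refine X_pow_natDegree_mem_leadingForms (Polynomial.monic_prod_of_monic _ _ fun b _ ↦ hmonic b) ?_
  rw [mem_vanishingIdeal_iff]
  intro x hx
  obtain ⟨b, hb⟩ := hV x hx i
  rw [map_prod, map_prod]
  exact Finset.prod_eq_zero (Finset.mem_univ b) (by simp [hb])

lemma esymmPow_mem_leadingForms [NeZero r]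
    (hV : ∀ x ∈ V, ∃ f : Fin n → Fin k, Function.Surjective f ∧ ∀ i, x i ^ r = α (f i))
    {d : ℕ} (hd : n < d + k) : esymmPow n r d ∈ leadingForms (vanishingIdeal ℂ V) (d * r) := by
  set P : PowerSeries ℂ := (∏ b, (1 + PowerSeries.C (α b) * PowerSeries.X))⁻¹ with hP
  have hP₀ : PowerSeries.coeff 0 P = 1 := by simp [P]
  refine mem_leadingForms_of_add_mem (isHomogeneous_esymmPow n r d)
    (q := ∑ a ∈ Finset.range d, PowerSeries.coeff (d - a) P • esymmPow n r a)
    (sum_mem fun a ha ↦ Submodule.smul_mem _ _ ?_) ?_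
  · exact mem_restrictSupport_degree_lt_of_isHomogeneous (isHomogeneous_esymmPow n r a)
      (Nat.mul_lt_mul_of_pos_right (Finset.mem_range.1 ha) (NeZero.pos r))
  rw [mem_vanishingIdeal_iff]
  intro x hx
  obtain ⟨f, hf, hxf⟩ := hV x hx
  have hcoeff := coeff_prod_one_add_mul_inv_eq_zero α hf (d := d) (by simpa using hd)
  rw [← hP, PowerSeries.coeff_mul, Finset.Nat.sum_antidiagonal_eq_sum_range_succ_mk,
    Finset.sum_range_succ_comm, Nat.sub_self, hP₀, mul_one] at hcoeff
  simp only [map_add, map_sum, map_smul, aeval_esymmPow, hxf, smul_eq_mul, ← hcoeff, mul_comm]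

lemma homogeneousComponent_mem_leadingForms_of_mem_idealJ [NeZero r]
    (hV : ∀ x ∈ V, ∃ f : Fin n → Fin k, Function.Surjective f ∧ ∀ i, x i ^ r = α (f i))
    {p : MvPolynomial (Fin n) ℂ} (hp : p ∈ idealJ n k r) (e : ℕ) :
    homogeneousComponent e p ∈ leadingForms (vanishingIdeal ℂ V) e := by
  refine homogeneousComponent_mem_leadingForms ?_ hp e
  rintro _ (⟨i, rfl⟩ | ⟨d, hd, -, rfl⟩)
  · refine ⟨k * r, X_pow_mem_leadingForms (α := α) (fun x hx i ↦ ?_) i⟩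
    obtain ⟨f, -, hf⟩ := hV x hx
    exact ⟨f i, hf i⟩
  · exact ⟨d * r, esymmPow_mem_leadingForms hV (by omega)⟩

/-- The index set of the points of the locus: a coloring of the `n` letters together with an
ordered set partition of the letters into `k` blocks, encoded by the block of each letter. -/
abbrev PointIndex (n k r : ℕ) : Type :=
  (Fin n → Fin r) × {f : Fin n → Fin k // Function.Surjective f}

/-- The point of `ℂⁿ` with coordinates `(b + 1) ω ^ c`, where `ω` is a primitive `r`-th root of
unity and `b` and `c` are the block and the color of the letter. -/
noncomputable def point (p : PointIndex n k r) (j : Fin n) : ℂ :=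
  (((p.2.1 j).val + 1 : ℕ) : ℂ) * Complex.exp (2 * Real.pi * Complex.I / r) ^ (p.1 j).val

lemma point_pow [NeZero r] (p : PointIndex n k r) (j : Fin n) :
    point p j ^ r = (((p.2.1 j).val + 1 : ℕ) : ℂ) ^ r := by
  have hω := (Complex.isPrimitiveRoot_exp r (NeZero.ne r)).pow_eq_one
  rw [point, mul_pow, ← pow_mul, mul_comm _ r, pow_mul, hω, one_pow, mul_one]

lemma point_injective [NeZero r] : Function.Injective (point : PointIndex n k r → Fin n → ℂ) := by
  have hω := Complex.isPrimitiveRoot_exp r (NeZero.ne r)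
  rintro ⟨c, f⟩ ⟨c', f'⟩ h
  have hblock (j : Fin n) : f.1 j = f'.1 j := by
    have hnorm := congrArg norm (congrFun h j)
    rw [point, point, norm_mul, norm_mul, norm_pow, norm_pow,
      hω.norm'_eq_one (NeZero.ne r)] at hnorm
    simpa [-Nat.cast_add, Fin.ext_iff] using hnorm
  have hcolor (j : Fin n) : c j = c' j := by
    have hj := congrFun h j
    simp only [point, hblock j] at hj
    exact Fin.ext (hω.pow_inj (c j).isLt (c' j).isLt
      (mul_left_cancel₀ (Nat.cast_ne_zero.2 (Nat.succ_ne_zero _)) hj))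
  exact Prod.ext (funext hcolor) (Subtype.ext (funext hblock))

lemma card_pointIndex_le_finrank [NeZero r] [Module.Finite ℂ (QuotS n k r)] :
    Fintype.card (PointIndex n k r) ≤ Module.finrank ℂ (QuotS n k r) := by
  rw [← Nat.card_eq_fintype_card, ← finrank_quotient_vanishingIdeal_range point_injective]
  refine Module.finrank_le_finrank_of_rank_le_rank ?_ (Module.rank_lt_aleph0 ..)
  rw [Cardinal.lift_le]
  refine rank_quotient_le_of_homogeneousComponent_mem_leadingForms fun p hp e ↦ ?_
  refine homogeneousComponent_mem_leadingForms_of_mem_idealJ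
    (α := fun b ↦ (((b : ℕ) + 1 : ℕ) : ℂ) ^ r) ?_ hp e
  rintro _ ⟨q, rfl⟩
  exact ⟨q.2.1, q.2.2, point_pow q⟩

end Generators

/-- The sort key of a colored letter, which turns `LetterLT` into a lexicographic order. -/
def letterKey {n r : ℕ} (x : Fin n × Fin r) : (Fin r)ᵒᵈ ×ₗ Fin n :=
  toLex (OrderDual.toDual x.2, x.1)

lemma letterKey_injective {n r : ℕ} : Function.Injective (letterKey : Fin n × Fin r → _) := by
  rintro ⟨a, c⟩ ⟨b, d⟩ h
  simpa [letterKey, and_comm] using h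

lemma letterKey_lt_letterKey {n r : ℕ} {x y : Fin n × Fin r} :
    letterKey x < letterKey y ↔ LetterLT x y := by
  simp [letterKey, LetterLT, Prod.Lex.toLex_lt_toLex]

namespace ColoredPerm

variable {n r : ℕ} {g : ColoredPerm n r}

@[ext] lemma ext {g h : ColoredPerm n r} (hperm : g.perm = h.perm) (hcolor : g.color = h.color) :
    g = h := by
  cases g
  cases h
  simp_all

lemma mem_Des {i : Fin n} :
    i ∈ g.Des ↔ ∃ h : i.val + 1 < n, LetterLT (g.letter ⟨i.val + 1, h⟩) (g.letter i) := by
  simp [Des]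

lemma letter_injective (g : ColoredPerm n r) : Function.Injective g.letter :=
  fun _ _ h ↦ g.perm.injective (Prod.ext_iff.1 h).1

lemma letterKey_lt_of_notMem_Des {i : Fin n} (h : i.val + 1 < n) (hi : i ∉ g.Des) :
    letterKey (g.letter i) < letterKey (g.letter ⟨i.val + 1, h⟩) := by
  refine lt_of_le_of_ne (le_of_not_gt fun hlt ↦ hi (mem_Des.2 ⟨h, letterKey_lt_letterKey.1 hlt⟩)) ?_
  exact (letterKey_injective.comp g.letter_injective).ne (by simp [Fin.ext_iff])

lemma strictMono_toLex_letterKey {β : Type*} [PartialOrder β] {b : Fin n → β} (hb : Monotone b)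
    (hDes : ∀ i ∈ g.Des, ∀ h : i.val + 1 < n, b i < b ⟨i.val + 1, h⟩) :
    StrictMono fun i ↦ toLex (b i, letterKey (g.letter i)) := by
  cases n with
  | zero => exact fun i ↦ i.elim0
  | succ n =>
    refine Fin.strictMono_iff_lt_succ.2 fun i ↦ Prod.Lex.toLex_lt_toLex.2 ?_
    by_cases hi : i.castSucc ∈ g.Des
    · exact Or.inl (hDes _ hi (by simp))
    · exact (hb i.castSucc_le_succ).lt_or_eq.imp_right
        fun h ↦ ⟨h, letterKey_lt_of_notMem_Des (by simp) hi⟩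

end ColoredPerm

section Counting

lemma count_notMem_of_subset_range {T : Finset ℕ} {m : ℕ} (hT : T ⊆ Finset.range m) :
    Nat.count (· ∉ T) m = m - T.card := by
  rw [Nat.count_eq_card_filter_range, ← Finset.sdiff_eq_filter, Finset.card_sdiff_of_subset hT,
    Finset.card_range]

lemma infinite_setOf_notMem (T : Finset ℕ) : {i | i ∉ T}.Infinite :=
  T.finite_toSet.infinite_compl

variable {n k : ℕ}

lemma count_notMem_lt {T : Finset ℕ} (hT : T ⊆ Finset.range (n - 1)) (hcard : T.card = n - k)
    (hk : k ≤ n) {i : ℕ} (hi : i < n) : Nat.count (· ∉ T) i < k := by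
  have hlast : n - 1 ∉ T := fun h ↦ by simpa using hT h
  calc Nat.count (· ∉ T) i ≤ Nat.count (· ∉ T) (n - 1) := Nat.count_monotone _ (by omega)
    _ < Nat.count (· ∉ T) n := Nat.count_strict_mono hlast (by omega)
    _ = k := by
      rw [count_notMem_of_subset_range (hT.trans (Finset.range_subset_range.2 (Nat.sub_le n 1)))]
      omega

lemma exists_count_notMem_eq {T : Finset ℕ} (hT : T ⊆ Finset.range n) (hcard : T.card = n - k)
    (hk : k ≤ n) {b : ℕ} (hb : b < k) : ∃ i < n, Nat.count (· ∉ T) i = b := by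
  refine ⟨Nat.nth (· ∉ T) b, Nat.nth_lt_of_lt_count ?_,
    Nat.count_nth_of_infinite (infinite_setOf_notMem T) b⟩
  rw [count_notMem_of_subset_range hT]
  omega

lemma eq_of_count_notMem_eq {T T' : Finset ℕ} (hT : T ⊆ Finset.range (n - 1))
    (hT' : T' ⊆ Finset.range (n - 1))
    (h : ∀ i < n, Nat.count (· ∉ T) i = Nat.count (· ∉ T') i) : T = T' := by
  ext i
  by_cases hi : i < n - 1
  · have hsucc := h (i + 1) (by omega)
    rw [Nat.count_succ, Nat.count_succ, h i (by omega)] at hsucc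
    by_cases i ∈ T <;> by_cases i ∈ T' <;> simp_all
  · exact iff_of_false (fun h ↦ hi (Finset.mem_range.1 (hT h)))
      (fun h ↦ hi (Finset.mem_range.1 (hT' h)))

end Counting

namespace ColoredPerm

variable {n k r : ℕ} {g : ColoredPerm n r} {e : Fin (n - k) → ℕ}

lemma Des_map_val_subset_range (g : ColoredPerm n r) :
    g.Des.map Fin.valEmbedding ⊆ Finset.range (n - 1) := by
  intro i hi
  obtain ⟨i, hDes, rfl⟩ := Finset.mem_map.1 hi
  obtain ⟨h, -⟩ := mem_Des.1 hDes
  exact Finset.mem_range.2 (Nat.lt_sub_of_add_lt h)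

/-- The position chosen by the `j`-th entry of `e`: an ascent of `g` which is preceded by
`j + (k - 1 - des g - e j)` ascents. -/
noncomputable def joinPos (g : ColoredPerm n r) (e : Fin (n - k) → ℕ) (j : Fin (n - k)) : ℕ :=
  Nat.nth (· ∉ g.Des.map Fin.valEmbedding) (j + (k - 1 - g.des - e j))

/-- The ascents of `g` at which the letter is joined to its successor. Cutting the word of `g` at
all other positions gives an ordered set partition of the letters. -/
noncomputable def joins (g : ColoredPerm n r) (e : Fin (n - k) → ℕ) : Finset ℕ :=
  Finset.univ.image (g.joinPos e)

lemma strictMono_joinPos (he : Antitone e) : StrictMono (g.joinPos e) := by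
  intro i j hij
  have heij := he hij.le
  rw [Fin.lt_def] at hij
  exact Nat.nth_strictMono (infinite_setOf_notMem _) (by omega)

lemma notMem_Des_of_mem_joins {i : Fin n} (hi : i.val ∈ g.joins e) : i ∉ g.Des := by
  obtain ⟨j, -, hj⟩ := Finset.mem_image.1 hi
  have hnth := Nat.nth_mem_of_infinite (infinite_setOf_notMem (g.Des.map Fin.valEmbedding))
    (j + (k - 1 - g.des - e j))
  rw [← joinPos, hj] at hnth
  exact fun h ↦ hnth (Finset.mem_map_of_mem Fin.valEmbedding h)

lemma joins_subset_range (hg : g.des < k) : g.joins e ⊆ Finset.range (n - 1) := by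
  intro i hi
  obtain ⟨j, -, rfl⟩ := Finset.mem_image.1 hi
  refine Finset.mem_range.2 (Nat.nth_lt_of_lt_count ?_)
  rw [count_notMem_of_subset_range g.Des_map_val_subset_range, Finset.card_map, ← des]
  omega

lemma card_joins (he : Antitone e) : (g.joins e).card = n - k := by
  simp [joins, Finset.card_image_of_injective _ (strictMono_joinPos he).injective]

lemma eq_of_joins_eq {e' : Fin (n - k) → ℕ} (he : Antitone e) (he' : Antitone e')
    (hlt : ∀ j, e j < k - g.des) (hlt' : ∀ j, e' j < k - g.des)
    (h : g.joins e = g.joins e') : e = e' := by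
  have hrange : Set.range (g.joinPos e) = Set.range (g.joinPos e') := by
    simpa [joins] using congrArg (fun T : Finset ℕ ↦ (T : Set ℕ)) h
  have hpos := (StrictMono.range_inj (strictMono_joinPos he) (strictMono_joinPos he')).1 hrange
  funext j
  have hj := Nat.nth_injective (infinite_setOf_notMem _) (congrFun hpos j)
  have := hlt j
  have := hlt' j
  omega

lemma strictMono_toLex_count_joins (g : ColoredPerm n r) (e : Fin (n - k) → ℕ) :
    StrictMono fun i : Fin n ↦
      toLex (Nat.count (· ∉ g.joins e) i, letterKey (g.letter i)) := by
  refine strictMono_toLex_letterKey (fun i j hij ↦ Nat.count_monotone _ hij) fun i hi h ↦ ?_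
  exact Nat.count_strict_mono (fun hmem ↦ notMem_Des_of_mem_joins hmem hi) (Nat.lt_succ_self i)

/-- The color of the letter `j` in `g`. -/
def letterColor (g : ColoredPerm n r) (j : Fin n) : Fin r := g.color (g.perm.symm j)

/-- The index of the block containing the letter `j` in the ordered set partition which `e`
attaches to `g`: the number of positions before `j` at which the word of `g` is cut. -/
noncomputable def letterBlock (g : ColoredPerm n r) (e : Fin (n - k) → ℕ) (j : Fin n) : ℕ :=
  Nat.count (· ∉ g.joins e) (g.perm.symm j)

lemma letterBlock_lt (hk : k ≤ n) (hg : g.des < k) (he : Antitone e) (j : Fin n) :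
    g.letterBlock e j < k :=
  count_notMem_lt (joins_subset_range hg) (card_joins he) hk (Fin.is_lt _)

lemma exists_letterBlock_eq (hk : k ≤ n) (hg : g.des < k) (he : Antitone e) {b : ℕ} (hb : b < k) :
    ∃ j, g.letterBlock e j = b := by
  have hT := (joins_subset_range (e := e) hg).trans
    (Finset.range_subset_range.2 (Nat.sub_le n 1))
  obtain ⟨i, hi, rfl⟩ := exists_count_notMem_eq hT (card_joins he) hk hb
  exact ⟨g.perm ⟨i, hi⟩, by simp [letterBlock]⟩

lemma strictMono_toLex_letterBlock (g : ColoredPerm n r) (e : Fin (n - k) → ℕ) :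
    StrictMono fun i ↦ toLex (g.letterBlock e (g.perm i),
      letterKey (g.perm i, g.letterColor (g.perm i))) := by
  simpa [letterBlock, letterColor, letter] using g.strictMono_toLex_count_joins e

lemma eq_of_letterColor_eq_of_letterBlock_eq {g' : ColoredPerm n r} {e' : Fin (n - k) → ℕ}
    (hcolor : g.letterColor = g'.letterColor) (hblock : g.letterBlock e = g'.letterBlock e') :
    g = g' := by
  -- The block and the color of each letter determine the sort keys, hence the sorted word.
  let key : Fin n → ℕ ×ₗ (Fin r)ᵒᵈ ×ₗ Fin n :=
    fun j ↦ toLex (g.letterBlock e j, letterKey (j, g.letterColor j))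
  have hg : StrictMono (key ∘ g.perm) := g.strictMono_toLex_letterBlock e
  have hg' : StrictMono (key ∘ g'.perm) := by
    simp only [key, hblock, hcolor]
    exact g'.strictMono_toLex_letterBlock e'
  have hrange : Set.range (key ∘ g.perm) = Set.range (key ∘ g'.perm) := by
    simp [Set.range_comp, g.perm.surjective.range_eq, g'.perm.surjective.range_eq]
  have hkey : key.Injective := fun i j hij ↦
    (Prod.ext_iff.1 (letterKey_injective (Prod.ext_iff.1 (toLex_inj.1 hij)).2)).1
  have hperm : g.perm = g'.perm :=
    Equiv.ext fun i ↦ hkey (congrFun ((StrictMono.range_inj hg hg').1 hrange) i)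
  refine ColoredPerm.ext hperm (funext fun i ↦ ?_)
  simpa [letterColor, ← hperm] using congrFun hcolor (g.perm i)

end ColoredPerm

section DescentData

open ColoredPerm

variable {n k r : ℕ}

/-- The pairs `(g, e)` which index the `(n,k)`-descent monomials (for `k ≤ n`). -/
def descentData (n k r : ℕ) : Set (ColoredPerm n r × (Fin (n - k) → ℕ)) :=
  {x | x.1.des < k ∧ Antitone x.2 ∧ ∀ j, x.2 j < k - x.1.des}

/-- The coloring of the letters together with their ordered set partition into `k` blocks. -/
noncomputable def toPointIndex (hk : k ≤ n) (x : descentData n k r) : PointIndex n k r :=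
  (x.1.1.letterColor, ⟨fun j ↦ ⟨x.1.1.letterBlock x.1.2 j, letterBlock_lt hk x.2.1 x.2.2.1 j⟩,
    fun b ↦ (exists_letterBlock_eq hk x.2.1 x.2.2.1 b.isLt).imp fun _ hj ↦ Fin.ext hj⟩)

lemma toPointIndex_injective (hk : k ≤ n) :
    Function.Injective (toPointIndex hk : descentData n k r → PointIndex n k r) := by
  rintro ⟨⟨g, e⟩, hg, he, hlt⟩ ⟨⟨g', e'⟩, hg', he', hlt'⟩ h
  obtain ⟨hcolor, hmap⟩ := Prod.ext_iff.1 h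
  have hblock : g.letterBlock e = g'.letterBlock e' :=
    funext fun j ↦ congrArg Fin.val (congrFun (Subtype.ext_iff.1 hmap) j)
  obtain rfl := eq_of_letterColor_eq_of_letterBlock_eq hcolor hblock
  have hjoins : g.joins e = g.joins e' :=
    eq_of_count_notMem_eq (joins_subset_range hg) (joins_subset_range hg') fun i hi ↦ by
      simpa [letterBlock] using congrFun hblock (g.perm ⟨i, hi⟩)
  obtain rfl := eq_of_joins_eq he he' hlt hlt' hjoins
  rfl

lemma finite_descentData (hk : k ≤ n) : (descentData n k r).Finite :=
  Finite.of_injective _ (toPointIndex_injective hk)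

lemma ncard_descentData_le (hk : k ≤ n) :
    (descentData n k r).ncard ≤ Fintype.card (PointIndex n k r) := by
  rw [← Nat.card_coe_set_eq, ← Nat.card_eq_fintype_card]
  exact Nat.card_le_card_of_injective _ (toPointIndex_injective hk)

end DescentData

namespace ColoredPerm

variable {n k r : ℕ}

/-- The exponent of the monomial `∏_i x_{π_i}^{r q_i + c_i}`. -/
noncomputable def exponent (g : ColoredPerm n r) (q : Fin n → ℕ) : Fin n →₀ ℕ :=
  Finsupp.equivFunOnFinite.symm fun j ↦ r * q (g.perm.symm j) + (g.color (g.perm.symm j)).val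

lemma exponent_perm (g : ColoredPerm n r) (q : Fin n → ℕ) (i : Fin n) :
    g.exponent q (g.perm i) = r * q i + (g.color i).val := by
  simp [exponent]

lemma monomial_exponent (g : ColoredPerm n r) (q : Fin n → ℕ) :
    (monomial (g.exponent q) 1 : MvPolynomial (Fin n) ℂ) =
      ∏ i, X (g.perm i) ^ (r * q i + (g.color i).val) := by
  rw [monomial_eq, C_1, one_mul, Finsupp.prod_fintype _ _ fun _ ↦ pow_zero _,
    ← Equiv.prod_comp g.perm fun j ↦ X j ^ g.exponent q j]
  simp only [exponent_perm]

/-- The integers `q_i` for which `x_{π_i}` has exponent `r q_i + c_i` in the descent monomial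
indexed by `(g, e)`. -/
noncomputable def descentQuotients (g : ColoredPerm n r) (e : Fin (n - k) → ℕ) : Fin n → ℕ :=
  g.dseq + Function.extend (Fin.castLE (Nat.sub_le n k)) e 0

lemma descentMonomial_mul_prod (g : ColoredPerm n r) (e : Fin (n - k) → ℕ) :
    g.descentMonomial * ∏ j : Fin (n - k), X (g.perm (Fin.castLE (Nat.sub_le n k) j)) ^ (r * e j) =
      monomial (g.exponent (g.descentQuotients e)) 1 := by
  have hextend : ∏ j : Fin (n - k),
        (X (g.perm (Fin.castLE (Nat.sub_le n k) j)) : MvPolynomial (Fin n) ℂ) ^ (r * e j) =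
      ∏ i, X (g.perm i) ^ (r * Function.extend (Fin.castLE (Nat.sub_le n k)) e 0 i) := by
    refine Fintype.prod_of_injective (Fin.castLE (Nat.sub_le n k)) (Fin.castLE_injective _) _ _
      (fun i hi ↦ ?_) fun j ↦ ?_
    · simp [Function.extend_apply' _ _ _ hi]
    · rw [(Fin.castLE_injective _).extend_apply]
  rw [hextend, descentMonomial, ← Finset.prod_mul_distrib, monomial_exponent]
  refine Finset.prod_congr rfl fun i _ ↦ ?_
  rw [← pow_add, descentQuotients, Pi.add_apply, mul_add, add_right_comm]

end ColoredPerm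

/-- The exponents of the `(n,k)`-descent monomials. -/
def descentExponents (n k r : ℕ) : Set (Fin n →₀ ℕ) :=
  (fun x ↦ x.1.exponent (x.1.descentQuotients x.2)) '' descentData n k r

lemma descentMonomials_eq_image (n k r : ℕ) :
    descentMonomials n k r = (monomial · 1) '' descentExponents n k r := by
  ext m
  simp [descentMonomials, descentExponents, descentData, ColoredPerm.descentMonomial_mul_prod,
    and_assoc, eq_comm]

lemma finite_descentMonomials {n k : ℕ} (hk : k ≤ n) (r : ℕ) : (descentMonomials n k r).Finite := by
  rw [descentMonomials_eq_image]
  exact ((finite_descentData hk).image _).image _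

lemma ncard_descentMonomials_le {n k : ℕ} (hk : k ≤ n) (r : ℕ) :
    (descentMonomials n k r).ncard ≤ Fintype.card (PointIndex n k r) := by
  rw [descentMonomials_eq_image, descentExponents, Set.image_image]
  exact (Set.ncard_image_le (finite_descentData hk)).trans (ncard_descentData_le hk)

section Weights

lemma sum_lt_sum_of_forall_notMem_lt {ι M : Type*} [AddCommMonoid M] [LinearOrder M]
    [IsOrderedCancelAddMonoid M] {w : ι → M} {S T : Finset ι} (hcard : S.card = T.card)
    (hne : S ≠ T) (h : ∀ i ∈ T, ∀ j ∉ T, w j < w i) : ∑ j ∈ S, w j < ∑ j ∈ T, w j := by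
  classical
  have hcard' : (S \ T).card = (T \ S).card := Finset.card_sdiff_comm hcard
  have hTS : (T \ S).Nonempty :=
    Finset.sdiff_nonempty.2 fun hsub ↦ hne (Finset.eq_of_subset_of_card_le hsub hcard.le).symm
  have hST : (S \ T).Nonempty := Finset.card_pos.1 (hcard' ▸ hTS.card_pos)
  obtain ⟨i, hi, hmin⟩ := Finset.exists_min_image (T \ S) w hTS
  rw [← Finset.sum_sdiff_lt_sum_sdiff]
  calc ∑ j ∈ S \ T, w j < ∑ _j ∈ S \ T, w i :=
        Finset.sum_lt_sum_of_nonempty hST fun j hj ↦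
          h i (Finset.mem_sdiff.1 hi).1 j (Finset.mem_sdiff.1 hj).2
    _ = (T \ S).card • w i := by rw [Finset.sum_const, hcard']
    _ ≤ ∑ j ∈ T \ S, w j := Finset.card_nsmul_le_sum _ _ _ hmin

variable {n r : ℕ}

/-- The weight of a letter `j` in an exponent `a`. Comparing weights compares the entries of `a`,
ties being broken in favor of smaller letters. -/
def weight (a : Fin n → ℕ) (j : Fin n) : ℕ := n * a j + j.rev.val

lemma weight_lt_weight {a : Fin n → ℕ} {i j : Fin n} :
    weight a j < weight a i ↔ a j < a i ∨ a j = a i ∧ i < j := by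
  have hi := i.rev.isLt
  have hj := j.rev.isLt
  rw [← Fin.rev_lt_rev, Fin.lt_def, weight, weight]
  rcases lt_trichotomy (a j) (a i) with h | h | h
  · have := Nat.mul_le_mul_left n (Nat.succ_le_of_lt h)
    rw [Nat.mul_succ] at this
    omega
  · simp [h]
  · have := Nat.mul_le_mul_left n (Nat.succ_le_of_lt h)
    rw [Nat.mul_succ] at this
    omega

lemma weight_injective (a : Fin n → ℕ) : Function.Injective (weight a) := by
  intro i j h
  have hij := weight_lt_weight.not.1 h.not_lt
  have hji := weight_lt_weight.not.1 h.symm.not_lt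
  omega

/-- The statistic which decreases under straightening. -/
def potential (a : Fin n → ℕ) : ℕ := ∑ j, weight a j ^ 2

lemma potential_add_setExp (a : Fin n →₀ ℕ) (S : Finset (Fin n)) :
    potential (a + setExp r S : Fin n →₀ ℕ) =
      potential a + S.card * (n * r) ^ 2 + 2 * (n * r) * ∑ j ∈ S, weight a j := by
  have hsq (j : Fin n) : weight (a + setExp r S : Fin n →₀ ℕ) j ^ 2 =
      weight a j ^ 2 + if j ∈ S then (n * r) ^ 2 + 2 * (n * r) * weight a j else 0 := by
    simp only [weight, Finsupp.add_apply, setExp_apply]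
    split_ifs <;> ring
  simp only [potential, hsq, Finset.sum_add_distrib, Finset.sum_ite_mem, Finset.univ_inter,
    Finset.sum_const, ← Finset.mul_sum, smul_eq_mul, add_assoc]

lemma potential_add_setExp_lt [NeZero n] [NeZero r] {a : Fin n →₀ ℕ} {S T : Finset (Fin n)}
    (hcard : S.card = T.card) (hne : S ≠ T) (h : ∀ i ∈ T, ∀ j ∉ T, weight a j < weight a i) :
    potential (a + setExp r S : Fin n →₀ ℕ) < potential (a + setExp r T : Fin n →₀ ℕ) := by
  have hpos : 0 < 2 * (n * r) := by simp [Nat.pos_of_neZero]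
  rw [potential_add_setExp, potential_add_setExp, hcard]
  exact Nat.add_lt_add_left
    (Nat.mul_lt_mul_of_pos_left (sum_lt_sum_of_forall_notMem_lt hcard hne h) hpos) _

end Weights

namespace ColoredPerm

variable {n r : ℕ} {g : ColoredPerm n r} {q u : Fin n → ℕ}

lemma dseq_eq_dseq_succ_add (g : ColoredPerm n r) (i : Fin n) (h : i.val + 1 < n) :
    g.dseq i = g.dseq ⟨i.val + 1, h⟩ + if i ∈ g.Des then 1 else 0 := by
  have hle (j : Fin n) : i ≤ j ↔ (⟨i.val + 1, h⟩ : Fin n) ≤ j ∨ i = j := by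
    simp only [Fin.le_def, Fin.ext_iff]
    omega
  simp only [dseq, hle]
  rw [Finset.filter_or, Finset.card_union_of_disjoint, Finset.filter_eq]
  · split_ifs <;> simp
  · refine Finset.disjoint_filter.2 fun j _ hj hij ↦ ?_
    simp only [Fin.le_def, Fin.ext_iff] at hj hij
    omega

lemma antitone_dseq (g : ColoredPerm n r) : Antitone g.dseq :=
  fun _ _ hij ↦ Finset.card_le_card (Finset.monotone_filter_right _ fun _ _ ↦ hij.trans)

lemma dseq_eq_zero_of_isLast (g : ColoredPerm n r) {i : Fin n} (h : i.val + 1 = n) :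
    g.dseq i = 0 := by
  rw [dseq, Finset.card_eq_zero, Finset.filter_eq_empty_iff]
  intro j hj hij
  obtain ⟨hlt, -⟩ := mem_Des.1 hj
  rw [Fin.le_def] at hij
  omega

lemma dseq_zero [NeZero n] (g : ColoredPerm n r) : g.dseq 0 = g.des := by
  simp [dseq, des]

/-- The `g`-partitions, in the sense of Stanley's theory of `P`-partitions: the sequences `q` which
weakly decrease and strictly decrease at the descents of `g`. They are encoded by the condition
that the pairs of an entry of `q` and a letter of `g` are sorted. -/
def IsPartition (g : ColoredPerm n r) (q : Fin n → ℕ) : Prop :=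
  StrictMono fun i ↦ toLex (OrderDual.toDual (q i), letterKey (g.letter i))

lemma isPartition_dseq_add (g : ColoredPerm n r) (hu : Antitone u) :
    g.IsPartition (g.dseq + u) := by
  refine strictMono_toLex_letterKey (g.antitone_dseq.add hu).dual_right fun i hi h ↦ ?_
  have hd := g.dseq_eq_dseq_succ_add i h
  have hui := hu (show i ≤ ⟨i.val + 1, h⟩ from Fin.le_def.2 (Nat.le_succ _))
  rw [if_pos hi] at hd
  rw [OrderDual.toDual_lt_toDual, Pi.add_apply, Pi.add_apply]
  omega

lemma IsPartition.succ_add_le (hq : g.IsPartition q) (i : Fin n) (h : i.val + 1 < n) :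
    q ⟨i.val + 1, h⟩ + (if i ∈ g.Des then 1 else 0) ≤ q i := by
  have hlt := hq (show i < ⟨i.val + 1, h⟩ from Fin.lt_def.2 (Nat.lt_succ_self _))
  rcases Prod.Lex.toLex_lt_toLex.1 hlt with hlt | ⟨heq, hkey⟩
  · have := OrderDual.toDual_lt_toDual.1 hlt
    split_ifs <;> omega
  · have hnot : i ∉ g.Des := fun hi ↦
      have ⟨_, hDes⟩ := mem_Des.1 hi
      hkey.asymm (letterKey_lt_letterKey.2 hDes)
    rw [if_neg hnot]
    exact (OrderDual.toDual_inj.1 heq).ge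

lemma IsPartition.dseq_le (hq : g.IsPartition q) : g.dseq ≤ q := by
  cases n with
  | zero => exact fun i ↦ i.elim0
  | succ n =>
    intro i
    induction i using Fin.reverseInduction with
    | last => simp [g.dseq_eq_zero_of_isLast]
    | cast i ih =>
      calc g.dseq i.castSucc = g.dseq i.succ + _ := g.dseq_eq_dseq_succ_add _ (by simp)
        _ ≤ q i.succ + _ := Nat.add_le_add_right ih _
        _ ≤ q i.castSucc := hq.succ_add_le i.castSucc (by simp)

lemma IsPartition.antitone_sub_dseq (hq : g.IsPartition q) : Antitone (q - g.dseq) := by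
  cases n with
  | zero => exact fun i ↦ i.elim0
  | succ n =>
    refine Fin.antitone_iff_succ_le.2 fun i ↦ ?_
    have hqi := hq.succ_add_le i.castSucc (by simp)
    have hdi := g.dseq_eq_dseq_succ_add i.castSucc (by simp)
    change q i.succ + _ ≤ _ at hqi
    change _ = g.dseq i.succ + _ at hdi
    simp only [Pi.sub_apply]
    omega

lemma isPartition_iff : g.IsPartition q ↔ ∃ u, Antitone u ∧ q = g.dseq + u := by
  refine ⟨fun hq ↦ ⟨q - g.dseq, hq.antitone_sub_dseq, (add_tsub_cancel_of_le hq.dseq_le).symm⟩, ?_⟩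
  rintro ⟨u, hu, rfl⟩
  exact g.isPartition_dseq_add hu

lemma weight_exponent_lt_weight_exponent {i j : Fin n} :
    weight (g.exponent q) (g.perm j) < weight (g.exponent q) (g.perm i) ↔
      toLex (OrderDual.toDual (q i), letterKey (g.letter i)) <
        toLex (OrderDual.toDual (q j), letterKey (g.letter j)) := by
  rw [weight_lt_weight, Prod.Lex.toLex_lt_toLex, letterKey_lt_letterKey, exponent_perm,
    exponent_perm]
  simp only [LetterLT, letter, OrderDual.toDual_lt_toDual, OrderDual.toDual_inj, Fin.lt_def,
    Fin.ext_iff]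
  have hi := (g.color i).isLt
  have hj := (g.color j).isLt
  rcases lt_trichotomy (q i) (q j) with h | h | h
  · have := Nat.mul_le_mul_left r (Nat.succ_le_of_lt h)
    rw [Nat.mul_succ] at this
    omega
  · rw [h]
    omega
  · have := Nat.mul_le_mul_left r (Nat.succ_le_of_lt h)
    rw [Nat.mul_succ] at this
    omega

lemma isPartition_iff_strictAnti_weight :
    g.IsPartition q ↔ StrictAnti fun i ↦ weight (g.exponent q) (g.perm i) :=
  forall₃_congr fun _ _ _ ↦ weight_exponent_lt_weight_exponent.symm

lemma exists_isPartition_exponent_eq [NeZero r] (a : Fin n →₀ ℕ) :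
    ∃ (g : ColoredPerm n r) (q : Fin n → ℕ), g.IsPartition q ∧ g.exponent q = a := by
  let π := Tuple.sort (OrderDual.toDual ∘ weight a)
  let g : ColoredPerm n r := ⟨π, fun i ↦ Fin.ofNat r (a (π i))⟩
  have ha : g.exponent (fun i ↦ a (π i) / r) = a := by
    refine Finsupp.ext (g.perm.surjective.forall.2 fun i ↦ ?_)
    rw [exponent_perm]
    exact Nat.div_add_mod _ _
  refine ⟨g, _, isPartition_iff_strictAnti_weight.2 ?_, ha⟩
  rw [ha]
  have hmono := (Tuple.monotone_sort (OrderDual.toDual ∘ weight a)).strictMono_of_injective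
    ((OrderDual.toDual.injective.comp (weight_injective a)).comp π.injective)
  exact hmono.dual_right

lemma exponent_add_indicator (g : ColoredPerm n r) (q : Fin n → ℕ) (p : Fin n → Prop)
    [DecidablePred p] :
    g.exponent (fun i ↦ q i + if p i then 1 else 0) =
      g.exponent q + setExp r ((Finset.univ.filter p).map g.perm.toEmbedding) := by
  refine Finsupp.ext (g.perm.surjective.forall.2 fun i ↦ ?_)
  simp only [Finsupp.add_apply, exponent_perm, setExp_apply, Finset.mem_map_equiv,
    Equiv.symm_apply_apply, Finset.mem_filter, Finset.mem_univ, true_and]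
  split_ifs <;> ring

end ColoredPerm

section Straightening

variable {n k r : ℕ}

lemma exponent_mem_descentExponents [NeZero n] {g : ColoredPerm n r} {u : Fin n → ℕ}
    (hu : Antitone u) (hzero : ∀ i : Fin n, n - k ≤ i.val → u i = 0)
    (hlt : ∀ i, g.dseq i + u i < k) :
    g.exponent (g.dseq + u) ∈ descentExponents n k r := by
  have hlt0 := hlt 0
  rw [g.dseq_zero] at hlt0
  refine ⟨(g, u ∘ Fin.castLE (Nat.sub_le n k)), ⟨by simp only; omega,
    hu.comp_monotone (Fin.strictMono_castLE _).monotone, fun j ↦ ?_⟩, ?_⟩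
  · have hj := hu (Fin.zero_le (Fin.castLE (Nat.sub_le n k) j))
    simp only [Function.comp_apply]
    omega
  · have hextend : Function.extend (Fin.castLE (Nat.sub_le n k))
        (u ∘ Fin.castLE (Nat.sub_le n k)) 0 = u := by
      funext i
      by_cases hi : i.val < n - k
      · exact (Fin.castLE_injective (Nat.sub_le n k)).extend_apply _ _ ⟨i.val, hi⟩
      · rw [Function.extend_apply' _ _ _ (by rintro ⟨j, rfl⟩; exact hi j.isLt), Pi.zero_apply,
          hzero i (not_lt.1 hi)]
    simp only [ColoredPerm.descentQuotients, hextend]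

lemma exists_eq_exponent_add_setExp {g : ColoredPerm n r} {u : Fin n → ℕ} (hu : Antitone u) :
    ∃ b : Fin n →₀ ℕ,
      g.exponent (g.dseq + u) =
          b + setExp r ((Finset.univ.filter (0 < u ·)).map g.perm.toEmbedding) ∧
        ∀ i ∈ (Finset.univ.filter (0 < u ·)).map g.perm.toEmbedding,
          ∀ j ∉ (Finset.univ.filter (0 < u ·)).map g.perm.toEmbedding, weight b j < weight b i := by
  -- Lowering the positive entries of `u` by one keeps the sequence a `g`-partition, so the word of
  -- `g` still sorts the letters by weight, and the set of positive entries is an initial segment.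
  have hpred : Antitone fun i ↦ u i - 1 := fun i j hij ↦ Nat.sub_le_sub_right (hu hij) 1
  refine ⟨g.exponent (g.dseq + fun i ↦ u i - 1), ?_, ?_⟩
  · rw [← g.exponent_add_indicator]
    congr 1
    funext i
    simp only [Pi.add_apply]
    split_ifs <;> omega
  · refine g.perm.surjective.forall.2 fun i hi ↦ g.perm.surjective.forall.2 fun j hj ↦ ?_
    simp only [Finset.mem_map_equiv, Equiv.symm_apply_apply, Finset.mem_filter, Finset.mem_univ,
      true_and, not_lt] at hi hj
    refine ColoredPerm.isPartition_iff_strictAnti_weight.1 (g.isPartition_dseq_add hpred) ?_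
    exact lt_of_not_ge fun hji ↦ (hj.trans_lt hi).not_ge (hu hji)

lemma exists_leading_set_of_notMem [NeZero n] [NeZero r] {a : Fin n →₀ ℕ}
    (hlt : ∀ j, a j < k * r) (ha : a ∉ descentExponents n k r) :
    ∃ (T : Finset (Fin n)) (b : Fin n →₀ ℕ), n - k + 1 ≤ T.card ∧ a = b + setExp r T ∧
      ∀ i ∈ T, ∀ j ∉ T, weight b j < weight b i := by
  obtain ⟨g, q, hq, rfl⟩ := ColoredPerm.exists_isPartition_exponent_eq (r := r) a
  obtain ⟨u, hu, rfl⟩ := ColoredPerm.isPartition_iff.1 hq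
  have hqlt (i : Fin n) : g.dseq i + u i < k := by
    have hi := hlt (g.perm i)
    rw [ColoredPerm.exponent_perm, mul_comm k] at hi
    exact Nat.lt_of_mul_lt_mul_left ((Nat.le_add_right _ _).trans_lt hi)
  obtain ⟨i, hi, hui⟩ : ∃ i : Fin n, n - k ≤ i.val ∧ u i ≠ 0 := by
    by_contra! hzero
    exact ha (exponent_mem_descentExponents hu hzero hqlt)
  obtain ⟨b, hab, hsep⟩ := exists_eq_exponent_add_setExp (g := g) hu
  refine ⟨_, b, ?_, hab, hsep⟩
  have hsub : Finset.Iic i ⊆ Finset.univ.filter (0 < u ·) := fun j hj ↦ by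
    simpa using (Nat.pos_of_ne_zero hui).trans_le (hu (Finset.mem_Iic.1 hj))
  have hcard := Finset.card_le_card hsub
  rw [Fin.card_Iic] at hcard
  rw [Finset.card_map]
  omega

lemma monomial_mem_idealJ {a : Fin n →₀ ℕ} {i : Fin n} (hi : k * r ≤ a i) :
    monomial a 1 ∈ idealJ n k r := by
  refine Ideal.mem_of_dvd _ ?_ (Ideal.subset_span (Or.inl ⟨i, rfl⟩))
  rw [X_pow_eq_monomial]
  exact monomial_dvd_monomial.2 ⟨Or.inr (Finsupp.single_le_iff.2 hi), dvd_rfl⟩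

lemma monomial_mul_esymmPow_mem_idealJ (b : Fin n →₀ ℕ) {T : Finset (Fin n)}
    (hT : n - k + 1 ≤ T.card) : monomial b 1 * esymmPow n r T.card ∈ idealJ n k r :=
  Ideal.mul_mem_left _ _ (Ideal.subset_span (Or.inr ⟨_, hT, by simpa using T.card_le_univ, rfl⟩))

lemma monomial_add_setExp_eq_sub (b : Fin n →₀ ℕ) (T : Finset (Fin n)) :
    (monomial (b + setExp r T) 1 : MvPolynomial (Fin n) ℂ) =
      monomial b 1 * esymmPow n r T.card -
        ∑ S ∈ (Finset.powersetCard T.card Finset.univ).erase T, monomial (b + setExp r S) 1 := by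
  rw [eq_sub_iff_add_eq, Finset.add_sum_erase _ (fun S ↦ monomial (b + setExp r S) 1) (by simp),
    esymmPow_eq_sum_monomial, Finset.mul_sum]
  simp only [monomial_mul, one_mul]

lemma monomial_mem_restrictSupport_sup [NeZero n] [NeZero r] (k : ℕ) (a : Fin n →₀ ℕ) :
    monomial a 1 ∈
      restrictSupport ℂ (descentExponents n k r) ⊔ (idealJ n k r).restrictScalars ℂ := by
  induction hN : potential a using Nat.strong_induction_on generalizing a with
  | _ N ih =>
    by_cases ha : a ∈ descentExponents n k r
    · exact Submodule.mem_sup_left ((monomial_mem_restrictSupport ℂ).2 (Or.inl ha))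
    by_cases hlt : ∀ j, a j < k * r
    · obtain ⟨T, b, hT, rfl, hsep⟩ := exists_leading_set_of_notMem hlt ha
      rw [monomial_add_setExp_eq_sub]
      refine Submodule.sub_mem _ (Submodule.mem_sup_right (monomial_mul_esymmPow_mem_idealJ b hT))
        (Submodule.sum_mem _ fun S hS ↦ ih _ ?_ _ rfl)
      obtain ⟨hne, hS⟩ := Finset.mem_erase.1 hS
      exact hN ▸ potential_add_setExp_lt (Finset.mem_powersetCard.1 hS).2 hne hsep
    · obtain ⟨j, hj⟩ := not_forall.1 hlt
      exact Submodule.mem_sup_right (monomial_mem_idealJ (not_lt.1 hj))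

lemma restrictSupport_descentExponents_sup_eq_top [NeZero n] [NeZero r] :
    restrictSupport ℂ (descentExponents n k r) ⊔ (idealJ n k r).restrictScalars ℂ = ⊤ := by
  rw [eq_top_iff, ← restrictSupport_univ ℂ, restrictSupport_eq_span, Submodule.span_le]
  rintro _ ⟨a, -, rfl⟩
  exact monomial_mem_restrictSupport_sup k a

end Straightening

section Basis

variable {n k r : ℕ}

lemma span_range_mk_descentMonomials [NeZero n] [NeZero r] :
    Submodule.span ℂ (Set.range fun m : descentMonomials n k r ↦
      (Ideal.Quotient.mk (idealJ n k r) m : QuotS n k r)) = ⊤ := by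
  rw [← Set.image_eq_range (Ideal.Quotient.mk (idealJ n k r)), descentMonomials_eq_image,
    span_mk_monomial_eq_top_iff]
  exact restrictSupport_descentExponents_sup_eq_top

lemma linearIndependent_mk_descentMonomials [NeZero n] [NeZero r] (hk : k ≤ n) :
    LinearIndependent ℂ fun m : descentMonomials n k r ↦
      (Ideal.Quotient.mk (idealJ n k r) m : QuotS n k r) := by
  have : Fintype (descentMonomials n k r) := (finite_descentMonomials hk r).fintype
  have hspan := span_range_mk_descentMonomials (n := n) (k := k) (r := r)
  have : Module.Finite ℂ (QuotS n k r) :=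
    ⟨⟨(Set.finite_range _).toFinset, by simpa using hspan⟩⟩
  refine linearIndependent_of_top_le_span_of_card_le_finrank hspan.ge ?_
  calc Fintype.card (descentMonomials n k r) = (descentMonomials n k r).ncard := by
        rw [← Nat.card_eq_fintype_card, Nat.card_coe_set_eq]
    _ ≤ Fintype.card (PointIndex n k r) := ncard_descentMonomials_le hk r
    _ ≤ Module.finrank ℂ (QuotS n k r) := card_pointIndex_le_finrank

end Basis

end DescentBasis

/-- The `(n,k)`-descent monomials descend to a basis of `S_{n,k}`: the residue classes of the
elements of the set `D_{n,k}` are linearly independent (in particular pairwise distinct) and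
span `S_{n,k}` over `ℂ`. -/
theorem mainTheorem7 (n k r : ℕ) (hn : 1 ≤ n) (hk : k ≤ n) (hr : 1 ≤ r) :
    LinearIndependent ℂ
      (fun m : DescentBasis.descentMonomials n k r =>
        (Ideal.Quotient.mk (DescentBasis.idealJ n k r)
          (m : MvPolynomial (Fin n) ℂ) : DescentBasis.QuotS n k r)) ∧
    Submodule.span ℂ
      (Set.range fun m : DescentBasis.descentMonomials n k r =>
        (Ideal.Quotient.mk (DescentBasis.idealJ n k r)
          (m : MvPolynomial (Fin n) ℂ) : DescentBasis.QuotS n k r)) = ⊤ := by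
  have : NeZero n := ⟨by omega⟩
  have : NeZero r := ⟨by omega⟩
  exact ⟨DescentBasis.linearIndependent_mk_descentMonomials hk,
    DescentBasis.span_range_mk_descentMonomials⟩
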